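/- A group is locally finite if each of its finitely generated subgroups is finite. A group $G$ of cardinality $\lambda$ is called universal for the locally finite groups of cardinality $\lambda$ if every locally finite group $H$ of cardinality $\lambda$ admits an injective homomorphism $H\to G$ ($G$ itself is not required to be locally finite). (1) Let $\mu$ and $\lambda$ be infinite regular cardinals (that is, $\mu=\mathrm{cf}(\mu)$ and $\lambda=\mathrm{cf}(\lambda)$) with $\mu^+<\lambda<2^{\mu}$, where $\mu^+$ is the successor cardinal of $\mu$. Then there is no group of cardinality $\lambda$ that is universal for the locally finite groups of cardinality $\lambda$. (2) In particular, if $\lambda$ is a regular cardinal with $\aleph_2\le\lambda<2^{\aleph_0}$, then there is no group of cardinality $\lambda$ that is universal for the locally finite groups of cardinality $\lambda$. -/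

import Mathlib

universe u

open Cardinal

/-- A group is locally finite if each of its finitely generated subgroups is finite. -/
def LocallyFiniteGroup (G : Type u) [Group G] : Prop :=
  ∀ K : Subgroup G, K.FG → Finite K

/-- `G` is a group of cardinality `κ` that is universal for the locally finite groups of
cardinality `κ`: each of them embeds into `G`. The group `G` itself need not be locally finite. -/
def IsUniversalForLocallyFinite (κ : Cardinal.{u}) (G : Type u) [Group G] : Prop :=
  #G = κ ∧
    ∀ (H : Type u) [Group H], LocallyFiniteGroup H → #H = κ →
      ∃ f : H →* G, Function.Injective f

/-! Club guessing fixes, at each δ in some S, μ many blocks p < q < r below δ; for every F, at some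
δ all these points are closed under F (`exists_guessing_tripleLadders`; this needs μ⁺ < κ). For a
group G enumerated in type κ, each triple of elements and each δ determine a subset of μ by a
property tested at q and r. This gives only κ < 2^μ subsets, so some X ⊆ μ is missed. A locally
finite H is built whose commutation relations encode X at every δ ∈ S
(`exists_locallyFiniteGroup_encoding`). If H embeds in G, reflection at a guessed δ
(`exists_reflecting`) forces the images of y δ, v δ, w δ to yield exactly X, a contradiction. -/

/-! ### Well orders of regular length -/

/-- Transfinite construction of a sequence whose terms are pairwise `R`-related in order. -/
theorem exists_seq_of_forall_extension {M : Type*} [LinearOrder M] [WellFoundedLT M] {T : Type*}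
    (R : T → T → Prop) (h : ∀ (j : M) (f : Set.Iio j → T), ∃ t, ∀ k, R (f k) t) :
    ∃ s : M → T, ∀ j k, k < j → R (s k) (s j) := by
  choose next hnext using h
  let s : M → T := wellFounded_lt.fix fun j ih => next j fun k => ih k.1 k.2
  refine ⟨s, fun j k hk => ?_⟩
  have hs : s j = next j fun k => s k.1 := wellFounded_lt.fix_eq _ j
  rw [hs]
  exact hnext j (fun k => s k.1) ⟨k, hk⟩

theorem exists_forall_lt_of_card_lt {c : Cardinal.{u}} (hc : c.IsRegular) {ι : Type u}
    (hι : #ι < c) (f : ι → c.ord.ToType) : ∃ b, ∀ i, f i < b := by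
  by_contra! h
  have hcof : IsCofinal (Set.range f) := fun b => by
    obtain ⟨i, hi⟩ := h b
    exact ⟨f i, ⟨i, rfl⟩, hi⟩
  have h1 := Order.cof_le hcof
  rw [Ordinal.cof_toType, hc.cof_ord] at h1
  exact absurd (h1.trans mk_range_le) (not_le.2 hι)

theorem card_Iio_lt {c : Cardinal.{u}} (x : c.ord.ToType) : #(Set.Iio x) < c := by
  simpa using mk_Iio_lt x

theorem exists_gt_of_isRegular {c : Cardinal.{u}} (hc : c.IsRegular) (x : c.ord.ToType) :
    ∃ y, x < y := by
  obtain ⟨b, hb⟩ := exists_forall_lt_of_card_lt hc (ι := PUnit)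
    (by simpa using hc.nat_lt 1) (fun _ => x)
  exact ⟨b, hb ⟨⟩⟩

theorem card_Iic_lt {c : Cardinal.{u}} (hc : c.IsRegular) (x : c.ord.ToType) :
    #(Set.Iic x) < c := by
  obtain ⟨y, hy⟩ := exists_gt_of_isRegular hc x
  exact (mk_le_mk_of_subset fun z hz => lt_of_le_of_lt hz hy).trans_lt (card_Iio_lt y)

/-! ### Closure points of functions -/

/-- The points whose initial segment is closed under `F`. -/
def closurePoints {W : Type*} [LT W] (F : W → W) : Set W := {δ | ∀ x < δ, F x < δ}

theorem closurePoints_anti {W : Type*} [Preorder W] {F F' : W → W} (h : ∀ x, F x ≤ F' x) :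
    closurePoints F' ⊆ closurePoints F := fun _ hδ x hx => (h x).trans_lt (hδ x hx)

/-- Iterate a function that strictly dominates `F` on initial segments: the least strict upper bound
of the iterates is closed, since any point below it is at most some iterate. -/
theorem exists_mem_closurePoints_gt {c : Cardinal.{u}} (hc : c.IsRegular) (hc0 : ℵ₀ < c)
    (F : c.ord.ToType → c.ord.ToType) (x : c.ord.ToType) : ∃ e ∈ closurePoints F, x < e := by
  have h1 : ∀ y : c.ord.ToType, ∃ b, ∀ z : Set.Iic y, max (F z) z < b := fun y =>
    exists_forall_lt_of_card_lt hc (card_Iic_lt hc y) _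
  choose h hh using h1
  let X : ℕ → c.ord.ToType := fun n => h^[n] x
  have hX : ∀ n, X (n + 1) = h (X n) := fun n => Function.iterate_succ_apply' h n x
  obtain ⟨b, hb⟩ := exists_forall_lt_of_card_lt hc (ι := ULift ℕ) (by simpa using hc0)
    (fun n => X n.down)
  let U : Set c.ord.ToType := {b | ∀ n, X n < b}
  have hU : U.Nonempty := ⟨b, fun n => hb ⟨n⟩⟩
  refine ⟨wellFounded_lt.min U hU, fun z hz => ?_, wellFounded_lt.min_mem U hU 0⟩
  have hz' : z ∉ U := fun hzU => wellFounded_lt.not_lt_min U hzU hz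
  simp only [U, Set.mem_ofPred_eq, not_forall, not_lt] at hz'
  obtain ⟨n, hn⟩ := hz'
  have h2 := (max_lt_iff.1 (hh (X n) ⟨z, hn⟩)).1
  rw [← hX] at h2
  exact h2.trans (wellFounded_lt.min_mem U hU (n + 1))

theorem exists_greatest_closurePoint_le {W : Type*} [LinearOrder W] [WellFoundedLT W]
    (F : W → W) (a : W) :
    ∃ e ∈ closurePoints F, e ≤ a ∧ ∀ e' ∈ closurePoints F, e' ≤ a → e' ≤ e := by
  let U : Set W := {g | ∀ e ∈ closurePoints F, e ≤ a → e ≤ g}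
  have ha : a ∈ U := fun e _ h => h
  refine ⟨wellFounded_lt.min U ⟨a, ha⟩, fun x hx => ?_, ?_, wellFounded_lt.min_mem U ⟨a, ha⟩⟩
  · have hx' : x ∉ U := fun hxU => wellFounded_lt.not_lt_min U hxU hx
    simp only [U, Set.mem_ofPred_eq, not_forall, not_le] at hx'
    obtain ⟨e, he, hea, hxe⟩ := hx'
    exact (he x hxe).trans_le (wellFounded_lt.min_mem U ⟨a, ha⟩ e he hea)
  · exact not_lt.1 (wellFounded_lt.not_lt_min U ha)

/-- The greatest closure point of `F` that is at most `a`. -/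
noncomputable def closureFloor {W : Type*} [LinearOrder W] [WellFoundedLT W]
    (F : W → W) (a : W) : W := (exists_greatest_closurePoint_le F a).choose

section closureFloor
variable {W : Type*} [LinearOrder W] [WellFoundedLT W]

theorem closureFloor_mem (F : W → W) (a : W) : closureFloor F a ∈ closurePoints F :=
  (exists_greatest_closurePoint_le F a).choose_spec.1

theorem closureFloor_le (F : W → W) (a : W) : closureFloor F a ≤ a :=
  (exists_greatest_closurePoint_le F a).choose_spec.2.1

theorem le_closureFloor {F : W → W} {a e : W} (he : e ∈ closurePoints F) (h : e ≤ a) :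
    e ≤ closureFloor F a :=
  (exists_greatest_closurePoint_le F a).choose_spec.2.2 e he h

end closureFloor

/-! ### Guessing closure points -/

/-- `g` enumerates increasingly a cofinal subset of the points below `δ`. -/
structure IsLadder {M W : Type*} [LT M] [LT W] (g : M → W) (δ : W) : Prop where
  strictMono : ∀ j k, k < j → g k < g j
  lt_top : ∀ j, g j < δ
  cofinal : ∀ x < δ, ∃ j, x < g j

theorem exists_ladder_closurePoints {μ κ : Cardinal.{u}} (hμ : μ.IsRegular) (hκ : κ.IsRegular)
    (hμκ : μ < κ) (F : κ.ord.ToType → κ.ord.ToType) :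
    ∃ (δ : κ.ord.ToType) (g : μ.ord.ToType → κ.ord.ToType), IsLadder g δ ∧
      ∀ j, g j ∈ closurePoints F := by
  obtain ⟨s, hs⟩ := exists_seq_of_forall_extension (M := μ.ord.ToType)
    (fun x y : closurePoints F => x < y) (by
      intro j f
      obtain ⟨b, hb⟩ := exists_forall_lt_of_card_lt hκ ((card_Iio_lt j).trans hμκ)
        (fun k => (f k).1)
      obtain ⟨e, he, hbe⟩ := exists_mem_closurePoints_gt hκ (hμ.aleph0_le.trans_lt hμκ) F b
      exact ⟨⟨e, he⟩, fun k => (hb k).trans hbe⟩)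
  obtain ⟨b, hb⟩ := exists_forall_lt_of_card_lt hκ (ι := μ.ord.ToType) (by simpa using hμκ)
    (fun j => (s j).1)
  let U : Set κ.ord.ToType := {b | ∀ j, (s j).1 < b}
  refine ⟨wellFounded_lt.min U ⟨b, hb⟩, fun j => (s j).1,
    ⟨hs, wellFounded_lt.min_mem U ⟨b, hb⟩, fun x hx => ?_⟩, fun j => (s j).2⟩
  have hx' : x ∉ U := fun hxU => wellFounded_lt.not_lt_min U hxU hx
  simp only [U, Set.mem_ofPred_eq, not_forall, not_lt] at hx'
  obtain ⟨j, hj⟩ := hx'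
  obtain ⟨k, hk⟩ := exists_gt_of_isRegular hμ j
  exact ⟨k, hj.trans_lt (hs k j hk)⟩

/-- Successive disjoint triples `p j < q j < r j` below `δ`. -/
structure IsTripleLadder {M W : Type*} [LT M] [LT W] (p q r : M → W) (δ : W) : Prop where
  p_lt_q : ∀ j, p j < q j
  q_lt_r : ∀ j, q j < r j
  r_lt : ∀ j, r j < δ
  r_lt_p : ∀ j k, k < j → r k < p j

theorem IsLadder.exists_isTripleLadder {μ : Cardinal.{u}} (hμ : μ.IsRegular) {W : Type u}
    [LinearOrder W] {g : μ.ord.ToType → W} {δ : W} (hg : IsLadder g δ)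
    {D : Set W} (hD : ∀ x < δ, ∃ d ∈ D, x < d ∧ d < δ) :
    ∃ p q r : μ.ord.ToType → W, IsTripleLadder p q r δ ∧
      ∀ j, p j ∈ D ∧ q j ∈ D ∧ r j ∈ D := by
  let T := {t : W × W × W // (t.1 ∈ D ∧ t.2.1 ∈ D ∧ t.2.2 ∈ D) ∧
    t.1 < t.2.1 ∧ t.2.1 < t.2.2 ∧ t.2.2 < δ}
  obtain ⟨s, hs⟩ := exists_seq_of_forall_extension (M := μ.ord.ToType)
    (fun x y : T => x.1.2.2 < y.1.1) (by
      intro j f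
      choose m hm using fun k => hg.cofinal (f k).1.2.2 (f k).2.2.2.2
      obtain ⟨b, hb⟩ := exists_forall_lt_of_card_lt hμ (card_Iio_lt j) m
      obtain ⟨p, hp, hbp, hpδ⟩ := hD _ (hg.lt_top b)
      obtain ⟨q, hq, hpq, hqδ⟩ := hD _ hpδ
      obtain ⟨r, hr, hqr, hrδ⟩ := hD _ hqδ
      exact ⟨⟨(p, q, r), ⟨hp, hq, hr⟩, hpq, hqr, hrδ⟩,
        fun k => ((hm k).trans (hg.strictMono _ _ (hb k))).trans hbp⟩)
  exact ⟨fun j => (s j).1.1, fun j => (s j).1.2.1, fun j => (s j).1.2.2,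
    ⟨fun j => (s j).2.2.1, fun j => (s j).2.2.2.1, fun j => (s j).2.2.2.2, hs⟩,
    fun j => (s j).2.1⟩

theorem exists_eventually_const_of_antitone {M W : Type*} [LinearOrder M] [Nonempty M]
    [LinearOrder W] [WellFoundedLT W] (f : M → W) (hf : Antitone f) :
    ∃ i, ∀ k, i ≤ k → f k = f i := by
  obtain ⟨i, hi⟩ := wellFounded_lt.min_mem (Set.range f) (Set.range_nonempty f)
  refine ⟨i, fun k hk => le_antisymm (hf hk) ?_⟩
  rw [hi]
  exact not_lt.1 (wellFounded_lt.not_lt_min (Set.range f) ⟨k, rfl⟩)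

/-- Given ladders `g δ` at the points of `S`, some `F` is such that the projections of the ladders
to the closure points of `F` guess the closure points of every function. -/
theorem exists_closureFloor_guessing {μ κ : Cardinal.{u}} (hμ : μ.IsRegular) (hκ : κ.IsRegular)
    (hμκ : Order.succ μ < κ) (S : Set κ.ord.ToType)
    (g : κ.ord.ToType → μ.ord.ToType → κ.ord.ToType)
    (hS : ∀ F, ∃ δ ∈ S, ∀ x < δ, ∃ e ∈ closurePoints F, x < e ∧ e < δ) :
    ∃ F, ∀ F', ∃ δ ∈ S, (∀ x < δ, ∃ e ∈ closurePoints F, x < e ∧ e < δ) ∧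
      ∀ j, closureFloor F (g δ j) ∈ closurePoints F' := by
  by_contra! hcon
  choose N hN using hcon
  have hμ' : (Order.succ μ).IsRegular := isRegular_succ hμ.aleph0_le
  -- If `N F` refutes every `F`, iterate μ⁺ times, each stage dominating all earlier stages and
  -- their refutations.
  obtain ⟨Fs, hFs⟩ := exists_seq_of_forall_extension (M := (Order.succ μ).ord.ToType)
    (fun F F' : κ.ord.ToType → κ.ord.ToType => ∀ x, F x ≤ F' x ∧ N F x ≤ F' x) (by
      intro i f
      choose b hb using fun x => exists_forall_lt_of_card_lt hκ ((card_Iio_lt i).trans hμκ)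
        (fun k => max (f k x) (N (f k) x))
      exact ⟨b, fun k x => max_le_iff.1 (hb x k).le⟩)
  choose G hG using fun x => exists_forall_lt_of_card_lt hκ
    (ι := (Order.succ μ).ord.ToType) (by simpa using hμκ) (fun i => Fs i x)
  have hGF : ∀ i, closurePoints G ⊆ closurePoints (Fs i) := fun i =>
    closurePoints_anti fun x => (hG x i).le
  obtain ⟨δ, hδ, hacc⟩ := hS G
  have : Nonempty (Order.succ μ).ord.ToType := nonempty_ord_toType hμ'.ne_zero
  have hanti : ∀ j, Antitone fun i => closureFloor (Fs i) (g δ j) := by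
    intro j k i hki
    rcases hki.eq_or_lt with rfl | hki
    · exact le_rfl
    · exact le_closureFloor (closurePoints_anti (fun x => (hFs i k hki x).1)
        (closureFloor_mem _ _)) (closureFloor_le _ _)
  choose i hi using fun j => exists_eventually_const_of_antitone _ (hanti j)
  -- Each projection decreases with the stage, hence stabilises; μ many stabilising stages have a
  -- common bound below μ⁺.
  obtain ⟨a, ha⟩ := exists_forall_lt_of_card_lt hμ' (ι := μ.ord.ToType)
    (by simp) i
  obtain ⟨b, hab⟩ := exists_gt_of_isRegular hμ' a
  obtain ⟨j, hj⟩ := hN (Fs a) δ hδ fun x hx => by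
    obtain ⟨e, he, h⟩ := hacc x hx
    exact ⟨e, hGF a he, h⟩
  apply hj
  have h1 : closureFloor (Fs a) (g δ j) = closureFloor (Fs b) (g δ j) :=
    (hi j a (ha j).le).trans (hi j b ((ha j).trans hab).le).symm
  rw [h1]
  exact closurePoints_anti (fun x => (hFs b a hab x).2) (closureFloor_mem _ _)

/-- The triples are chosen inside the projected ladder, which is cofinal in δ because closure points
of the guessing function accumulate there. -/
theorem exists_guessing_tripleLadders {μ κ : Cardinal.{u}} (hμ : μ.IsRegular) (hκ : κ.IsRegular)
    (hμκ : Order.succ μ < κ) :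
    ∃ (S : Set κ.ord.ToType) (p q r : κ.ord.ToType → μ.ord.ToType → κ.ord.ToType),
      (∀ δ ∈ S, IsTripleLadder (p δ) (q δ) (r δ) δ) ∧
      ∀ F, ∃ δ ∈ S, ∀ j, p δ j ∈ closurePoints F ∧ q δ j ∈ closurePoints F ∧
        r δ j ∈ closurePoints F := by
  choose g hg using fun δ : κ.ord.ToType => show ∃ g : μ.ord.ToType → κ.ord.ToType,
    (∃ g', IsLadder (M := μ.ord.ToType) g' δ) → IsLadder g δ from by
      by_cases h : ∃ g', IsLadder (M := μ.ord.ToType) g' δ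
      · exact h.imp fun g' hg' _ => hg'
      · exact ⟨fun _ => δ, fun h' => absurd h' h⟩
  obtain ⟨F, hF⟩ := exists_closureFloor_guessing hμ hκ hμκ
    {δ | ∃ g', IsLadder (M := μ.ord.ToType) g' δ} g (by
      intro F
      obtain ⟨δ, g', hg', hmem⟩ :=
        exists_ladder_closurePoints hμ hκ ((Order.lt_succ μ).trans hμκ) F
      refine ⟨δ, ⟨g', hg'⟩, fun x hx => ?_⟩
      obtain ⟨j, hj⟩ := hg'.cofinal x hx
      exact ⟨g' j, hmem j, hj, hg'.lt_top j⟩)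
  let S : Set κ.ord.ToType := {δ | (∃ g', IsLadder (M := μ.ord.ToType) g' δ) ∧
    ∀ x < δ, ∃ e ∈ closurePoints F, x < e ∧ e < δ}
  have hS : ∀ δ, ∃ p q r : μ.ord.ToType → κ.ord.ToType, δ ∈ S → IsTripleLadder p q r δ ∧
      ∀ j, p j ∈ Set.range (fun j => closureFloor F (g δ j)) ∧
        q j ∈ Set.range (fun j => closureFloor F (g δ j)) ∧
        r j ∈ Set.range (fun j => closureFloor F (g δ j)) := by
    intro δ
    by_cases hδ : δ ∈ S
    · obtain ⟨p, q, r, h⟩ := (hg δ hδ.1).exists_isTripleLadder hμ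
        (D := Set.range (fun j => closureFloor F (g δ j))) (by
          intro x hx
          obtain ⟨e, he, hxe, heδ⟩ := hδ.2 x hx
          obtain ⟨j, hj⟩ := (hg δ hδ.1).cofinal e heδ
          exact ⟨_, ⟨j, rfl⟩, hxe.trans_le (le_closureFloor he hj.le),
            (closureFloor_le F _).trans_lt ((hg δ hδ.1).lt_top j)⟩)
      exact ⟨p, q, r, fun _ => h⟩
    · exact ⟨fun _ => δ, fun _ => δ, fun _ => δ, fun h => absurd h hδ⟩
  choose p q r hpqr using hS
  refine ⟨S, p, q, r, fun δ hδ => (hpqr δ hδ).1, fun F' => ?_⟩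
  obtain ⟨δ, hδ, hacc, hmem⟩ := hF F'
  have hsub : Set.range (fun j => closureFloor F (g δ j)) ⊆ closurePoints F' :=
    Set.range_subset_iff.2 hmem
  exact ⟨δ, ⟨hδ, hacc⟩, fun j => (hpqr δ ⟨hδ, hacc⟩).2 j |>.imp (@hsub _)
    (And.imp (@hsub _) (@hsub _))⟩

/-! ### Locally finite subgroups of powers of a finite group -/

/-- Elements of the closure agree at coordinates where all generators agree, and the generators have
only finitely many joint values. -/
theorem finite_closure_of_finite_pi {I K : Type*} [Group K] [Finite K] {s : Set (I → K)}
    (hs : s.Finite) : Finite (Subgroup.closure s) := by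
  have hfac : ∀ x ∈ Subgroup.closure s, ∀ i j : I, (∀ g : s, g.1 i = g.1 j) → x i = x j := by
    intro x hx i j hij
    induction hx using Subgroup.closure_induction with
    | mem x hx => exact hij ⟨x, hx⟩
    | one => rfl
    | mul x y _ _ hx hy => simp [hx, hy]
    | inv x _ hx => simp [hx]
  have : Finite s := hs
  let c : I → (s → K) := fun i g => g.1 i
  refine Finite.of_injective
    (fun (x : Subgroup.closure s) (k : Set.range c) => x.1 k.2.choose) fun x y hxy => ?_
  ext i
  have h := congrFun hxy ⟨c i, i, rfl⟩
  have hc : c (Exists.choose (⟨i, rfl⟩ : ∃ j, c j = c i)) = c i :=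
    Exists.choose_spec (⟨i, rfl⟩ : ∃ j, c j = c i)
  rw [hfac x.1 x.2 i _ fun g => (congrFun hc g).symm,
    hfac y.1 y.2 i _ fun g => (congrFun hc g).symm]
  exact h

theorem locallyFiniteGroup_subgroup_pi {I : Type u} {K : Type} [Group K] [Finite K]
    (H : Subgroup (I → K)) : LocallyFiniteGroup H := by
  intro L hL
  obtain ⟨t, rfl⟩ := hL
  have hfin : Finite ((Subgroup.closure (t : Set H)).map H.subtype) := by
    rw [MonoidHom.map_closure]
    exact finite_closure_of_finite_pi (t.finite_toSet.image _)
  exact Finite.of_equiv _ ((Subgroup.closure (t : Set H)).equivMapOfInjective H.subtype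
    H.subtype_injective).symm.toEquiv

/-! ### A locally finite group encoding a pair of relations -/

open Equiv (Perm)
open scoped commutatorElement

/-- Conjugation by `z` can be imitated on `w₁` alone by `s` and on `w₂` alone by `t`, both commuting
with `d`; doing it on both at once destroys commutation with `d`. -/
theorem perm_four_configuration :
    ∃ d w₁ w₂ s t z : Perm (Fin 4), Commute d s ∧ Commute d t ∧
      s * w₁ * s⁻¹ = z * w₁ * z⁻¹ ∧ t * w₂ * t⁻¹ = z * w₂ * z⁻¹ ∧
      Commute ⁅w₁, w₂⁆ d ∧ ¬ Commute ⁅z * w₁ * z⁻¹, z * w₂ * z⁻¹⁆ d := by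
  refine ⟨Equiv.swap 2 3, Equiv.swap 1 2 * Equiv.swap 2 3, Equiv.swap 0 1 * Equiv.swap 0 2,
    Equiv.swap 2 3, Equiv.swap 0 1, Equiv.swap 1 2, ?_⟩
  simp only [commute_iff_eq, commutatorElement_def]
  decide

/-- Assignments of permutations satisfying the commutation relations prescribed by `P` and `Q`. -/
structure RelationModel {W : Type u} [LT W] (P : W → W → Prop) (Q : W → W → W → Prop) :
    Type u where
  a : W → Perm (Fin 4)
  y : W → Perm (Fin 4)
  v : W → Perm (Fin 4)
  w : W → Perm (Fin 4)
  commute_a_y : ∀ β δ, β < δ → Commute (a β) (y δ)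
  y_mul : ∀ γ δ, P γ δ → y γ * w δ = v δ * y γ
  commute_commutator : ∀ β γ δ, Q β γ δ → Commute ⁅w γ, w δ⁆ (a β)

namespace RelationModel
variable {W : Type u} [LinearOrder W] {P : W → W → Prop} {Q : W → W → W → Prop}

theorem exists_a_ne_one (P : W → W → Prop) (Q : W → W → W → Prop) (β : W) :
    ∃ m : RelationModel P Q, m.a β ≠ 1 ∧ ∀ γ, γ ≠ β → m.a γ = 1 := by
  refine ⟨⟨Function.update 1 β (Equiv.swap 0 1), 1, 1, 1, by simp, by simp, by simp⟩, ?_, ?_⟩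
  · simp only [Function.update_self]
    decide
  · intro γ hγ
    simp [Function.update_of_ne hγ]

/-- Take y η to be `s`, `t` or `z` according to which of γ, δ it must serve. Only `z` fails to
commute with `d`, and then `hPQ` gives η ≤ β, where no commutation is demanded. -/
theorem exists_not_commute (hPQ : ∀ β γ δ η, Q β γ δ → P η γ → P η δ → η ≤ β)
    (hQ : ∀ β γ δ, Q β γ δ → γ < δ) {β γ δ : W} (h : Q β γ δ) :
    ∃ m : RelationModel P Q, ¬ Commute ⁅m.v γ, m.v δ⁆ (m.a β) := by
  classical
  obtain ⟨d, w₁, w₂, s, t, z, hds, hdt, hs, ht, hw, hv⟩ := perm_four_configuration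
  have hγδ := hQ β γ δ h
  let w : W → Perm (Fin 4) := fun x => if x = γ then w₁ else if x = δ then w₂ else 1
  let v : W → Perm (Fin 4) := fun x => z * w x * z⁻¹
  let a : W → Perm (Fin 4) := fun x => if x = β then d else 1
  let y : W → Perm (Fin 4) := fun η =>
    if P η γ then (if P η δ then z else s) else (if P η δ then t else 1)
  have hwγ : w γ = w₁ := by simp [w]
  have hwδ : w δ = w₂ := by simp [w, hγδ.ne']
  refine ⟨⟨a, y, v, w, fun β' δ' hlt => ?_, fun η δ' hP => ?_, fun β' γ' δ' hQ' => ?_⟩, ?_⟩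
  · by_cases hβ : β' = β
    · subst hβ
      simp only [a, y, if_true]
      split_ifs with h1 h2 h3
      · exact absurd (hPQ _ _ _ _ h h1 h2) (not_le.2 hlt)
      · exact hds
      · exact hdt
      · exact Commute.one_right d
    · simp [a, hβ]
  · rw [← mul_inv_eq_iff_eq_mul]
    by_cases h1 : δ' = γ
    · subst h1
      simp only [y, v, hwγ, if_pos hP]
      split_ifs
      · rfl
      · exact hs
    by_cases h2 : δ' = δ
    · subst h2
      simp only [y, v, hwδ, if_pos hP]
      split_ifs
      · rfl
      · exact ht
    simp [v, w, h1, h2]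
  · by_cases hβ : β' = β
    · subst hβ
      simp only [a, if_true]
      have hlt := hQ _ _ _ hQ'
      by_cases h1 : γ' = γ
      · subst h1
        by_cases h2 : δ' = δ
        · subst h2
          rwa [hwγ, hwδ]
        · simp [w, h2, hlt.ne', commutatorElement_def]
      · by_cases h2 : γ' = δ
        · subst h2
          simp [w, hlt.ne', (hγδ.trans hlt).ne', commutatorElement_def]
        · simp [w, h1, h2, commutatorElement_def]
    · simp [a, hβ]
  · simpa [v, a, hwγ, hwδ] using hv

/-- The tautological generators of the power of `Perm (Fin 4)` over all models. -/
def generator (P : W → W → Prop) (Q : W → W → W → Prop) :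
    (W ⊕ W) ⊕ (W ⊕ W) → RelationModel P Q → Perm (Fin 4)
  | .inl (.inl x), m => m.a x
  | .inl (.inr x), m => m.y x
  | .inr (.inl x), m => m.v x
  | .inr (.inr x), m => m.w x

/-- The subgroup generated by the tautological generators. -/
def group (P : W → W → Prop) (Q : W → W → W → Prop) :
    Subgroup (RelationModel P Q → Perm (Fin 4)) :=
  (FreeGroup.lift (generator P Q)).range

/-- A tautological generator as an element of the generated subgroup. -/
def gen (P : W → W → Prop) (Q : W → W → W → Prop) (x : (W ⊕ W) ⊕ (W ⊕ W)) : group P Q :=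
  ⟨generator P Q x, FreeGroup.of x, by simp⟩

theorem card_group [Infinite W] (P : W → W → Prop) (Q : W → W → W → Prop) :
    #(group P Q) = #W := by
  apply le_antisymm
  · have hsurj := (FreeGroup.lift (generator P Q)).rangeRestrict_surjective
    refine (mk_le_of_surjective hsurj).trans ?_
    have hW := aleph0_le_mk W
    rw [mk_freeGroup]
    simp [add_eq_self hW, hW]
  · refine mk_le_of_injective (f := fun x => gen P Q (.inl (.inl x))) fun x x' hxx => ?_
    by_contra hne
    obtain ⟨m, hm, hm'⟩ := exists_a_ne_one P Q x
    have h := congrFun (congrArg Subtype.val hxx) m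
    exact hm (h.trans (hm' x' (Ne.symm hne)))

theorem locallyFiniteGroup_group (P : W → W → Prop) (Q : W → W → W → Prop) :
    LocallyFiniteGroup (group P Q) := locallyFiniteGroup_subgroup_pi _

end RelationModel

/-- A locally finite group of cardinality `#W` with prescribed commutation relations. -/
theorem exists_locallyFiniteGroup_encoding {W : Type u} [LinearOrder W] [Infinite W]
    {P : W → W → Prop} {Q : W → W → W → Prop}
    (hPQ : ∀ β γ δ η, Q β γ δ → P η γ → P η δ → η ≤ β)
    (hQ : ∀ β γ δ, Q β γ δ → γ < δ) :
    ∃ (H : Type u) (_ : Group H), LocallyFiniteGroup H ∧ #H = #W ∧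
      ∃ a y v w : W → H, (∀ β δ, β < δ → Commute (a β) (y δ)) ∧
        (∀ γ δ, P γ δ → y γ * w δ = v δ * y γ) ∧
        (∀ β γ δ, Q β γ δ → Commute ⁅w γ, w δ⁆ (a β)) ∧
        ∀ β γ δ, Q β γ δ → ¬ Commute ⁅v γ, v δ⁆ (a β) := by
  refine ⟨RelationModel.group P Q, inferInstance, RelationModel.locallyFiniteGroup_group P Q,
    RelationModel.card_group P Q, fun x => RelationModel.gen P Q (.inl (.inl x)),
    fun x => RelationModel.gen P Q (.inl (.inr x)), fun x => RelationModel.gen P Q (.inr (.inl x)),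
    fun x => RelationModel.gen P Q (.inr (.inr x)), ?_, ?_, ?_, ?_⟩
  · exact fun β δ h => Subtype.ext (funext fun m => m.commute_a_y β δ h)
  · exact fun γ δ h => Subtype.ext (funext fun m => m.y_mul γ δ h)
  · exact fun β γ δ h => Subtype.ext (funext fun m => m.commute_commutator β γ δ h)
  · intro β γ δ h hcomm
    obtain ⟨m, hm⟩ := RelationModel.exists_not_commute hPQ hQ h
    exact hm (congrFun (congrArg Subtype.val hcomm) m)

/-! ### Nonexistence of universal groups -/

/-- Closure points of a suitable function reflect the binary relation `p`. -/
theorem exists_reflecting {κ : Cardinal.{u}} (hκ : κ.IsRegular)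
    (p : κ.ord.ToType → κ.ord.ToType → Prop) :
    ∃ F, ∀ e ∈ closurePoints F, ∀ α < e, ∀ g < e, ∀ δ, α ≤ δ → p g δ →
      ∃ δ', α ≤ δ' ∧ δ' < e ∧ p g δ' := by
  have h1 : ∀ α g : κ.ord.ToType, ∃ δ', ∀ δ, α ≤ δ → p g δ → α ≤ δ' ∧ p g δ' := by
    intro α g
    by_cases h : ∃ δ, α ≤ δ ∧ p g δ
    · exact h.imp fun δ hδ _ _ _ => hδ
    · exact ⟨α, fun δ h1 h2 => absurd ⟨δ, h1, h2⟩ h⟩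
  choose N hN using h1
  choose F hF using fun x : κ.ord.ToType => exists_forall_lt_of_card_lt hκ
    (ι := Set.Iic x × Set.Iic x)
    (by
      rw [← mul_def]
      exact mul_lt_of_lt hκ.aleph0_le (card_Iic_lt hκ x) (card_Iic_lt hκ x))
    (fun i => N i.1 i.2)
  refine ⟨F, fun e he α hα g hg δ hαδ hp =>
    ⟨N α g, (hN α g δ hαδ hp).1, ?_, (hN α g δ hαδ hp).2⟩⟩
  have hb := hF (max α g)
    (⟨α, Set.mem_Iic.2 (le_max_left α g)⟩, ⟨g, Set.mem_Iic.2 (le_max_right α g)⟩)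
  exact hb.trans (he _ (max_lt hα hg))

theorem not_exists_isUniversalForLocallyFinite {μ κ : Cardinal.{u}} (hμ : μ.IsRegular)
    (hκ : κ.IsRegular) (hμκ : Order.succ μ < κ) (hκμ : κ < 2 ^ μ) :
    ¬ ∃ (G : Type u) (_ : Group G), IsUniversalForLocallyFinite κ G := by
  rintro ⟨G, _, hG, huniv⟩
  obtain ⟨S, p, q, r, hS, hguess⟩ := exists_guessing_tripleLadders hμ hκ hμκ
  obtain ⟨e⟩ : Nonempty (G ≃ κ.ord.ToType) := Cardinal.eq.1 (by rw [hG, mk_ord_toType])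
  have : Infinite κ.ord.ToType := infinite_iff.2 (by simpa using hκ.aleph0_le)
  let inv : G × G × G × κ.ord.ToType → Set μ.ord.ToType := fun c =>
    {j | ∀ d, e d < q c.2.2.2 j → Commute d c.1 →
      ∃ y, e y < r c.2.2.2 j ∧ Commute d y ∧ y * c.2.2.1 = c.2.1 * y}
  obtain ⟨X, hX⟩ : ∃ X, ∀ c, inv c ≠ X := by
    by_contra! h
    have h1 := mk_le_of_surjective (f := inv) h
    simp only [mk_prod, lift_id, hG, mk_ord_toType, mul_eq_self hκ.aleph0_le, mk_set] at h1
    exact absurd h1 (not_le.2 hκμ)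
  let P : κ.ord.ToType → κ.ord.ToType → Prop := fun γ δ =>
    δ ∈ S ∧ ∃ j ∈ X, q δ j ≤ γ ∧ γ < r δ j
  let Q : κ.ord.ToType → κ.ord.ToType → κ.ord.ToType → Prop := fun β γ δ =>
    δ ∈ S ∧ ∃ j ∉ X, β = p δ j ∧ q δ j ≤ γ ∧ γ < r δ j
  obtain ⟨H, _, hlf, hcard, a, y, v, w, hay, hP, hQ, hQ'⟩ :=
    exists_locallyFiniteGroup_encoding (P := P) (Q := Q)
      (by
        -- Since η < γ, the block k of η is not after the block j of γ; k ≠ j as only k is in `X`;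
        -- so η lies before β = p δ j.
        rintro β γ δ η ⟨hδ, j, hj, rfl, hqγ, hγr⟩ ⟨hγ, i, -, -, hηr⟩ ⟨-, k, hk, hqη, hηk⟩
        have hηγ : η < γ := hηr.trans ((hS γ hγ).r_lt i)
        rcases lt_trichotomy j k with h | rfl | h
        · exact absurd ((hηγ.trans hγr).trans ((hS δ hδ).r_lt_p k j h))
            (not_lt.2 (((hS δ hδ).p_lt_q k).le.trans hqη))
        · exact absurd hk hj
        · exact (hηk.trans ((hS δ hδ).r_lt_p j k h)).le)
      (by
        rintro β γ δ ⟨hδ, j, -, -, -, hγr⟩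
        exact hγr.trans ((hS δ hδ).r_lt j))
  obtain ⟨f, hf⟩ := huniv H hlf (by rw [hcard, mk_ord_toType])
  obtain ⟨F₁, hF₁⟩ := exists_reflecting hκ fun g δ => Commute (e.symm g) (f (y δ))
  obtain ⟨F₂, hF₂⟩ := exists_reflecting hκ fun g δ =>
    e.symm g * f (w δ) = f (v δ) * e.symm g
  let F : κ.ord.ToType → κ.ord.ToType := fun x =>
    max (max (F₁ x) (F₂ x)) (max (e (f (a x))) (e (f (y x))))
  obtain ⟨δ, hδ, hmem⟩ := hguess F
  have hF₁' : closurePoints F ⊆ closurePoints F₁ :=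
    closurePoints_anti fun x => (le_max_left _ _).trans (le_max_left _ _)
  have hF₂' : closurePoints F ⊆ closurePoints F₂ :=
    closurePoints_anti fun x => (le_max_right _ _).trans (le_max_left _ _)
  have hFa : ∀ b ∈ closurePoints F, ∀ x < b, e (f (a x)) < b := fun b hb x hx =>
    ((le_max_left _ _).trans (le_max_right _ _)).trans_lt (hb x hx)
  have hFy : ∀ b ∈ closurePoints F, ∀ x < b, e (f (y x)) < b := fun b hb x hx =>
    ((le_max_right _ _).trans (le_max_right _ _)).trans_lt (hb x hx)
  have hL := hS δ hδ
  apply hX (f (y δ), f (v δ), f (w δ), δ)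
  ext j
  obtain ⟨-, hq, hr⟩ := hmem j
  have hqδ : q δ j ≤ δ := ((hL.q_lt_r j).trans (hL.r_lt j)).le
  constructor
  · intro hj
    by_contra hjX
    have hpδ : p δ j < δ := (hL.p_lt_q j).trans_le hqδ
    -- Test with the image of a (p δ j). The resulting `z` has index below r, so reflection makes it
    -- also conjugate w γ to v γ for some γ in the block, which transports the commutator relation
    -- that `hQ'` forbids.
    obtain ⟨z, hz, hdz, hzδ⟩ := hj (f (a (p δ j))) (hFa _ hq _ (hL.p_lt_q j))
      ((hay _ _ hpδ).map f)
    obtain ⟨γ, hqγ, hγr, hzγ⟩ := hF₂ _ (hF₂' hr) _ (hL.q_lt_r j) (e z) hz δ hqδ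
      (by simpa using hzδ)
    rw [e.symm_apply_apply] at hzγ
    have hQj : Q (p δ j) γ δ := ⟨hδ, j, hjX, rfl, hqγ, hγr⟩
    apply hQ' _ _ _ hQj
    have h1 : SemiconjBy z ⁅f (w γ), f (w δ)⁆ ⁅f (v γ), f (v δ)⁆ := by
      have h2 : SemiconjBy z (f (w γ)) (f (v γ)) := hzγ
      have h3 : SemiconjBy z (f (w δ)) (f (v δ)) := hzδ
      exact ((h2.mul_right h3).mul_right h2.inv_right).mul_right h3.inv_right
    have h4 : Commute ⁅f (v γ), f (v δ)⁆ (f (a (p δ j))) := by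
      have h5 := (hQ _ _ _ hQj).map f
      rw [map_commutatorElement] at h5
      have h6 : ⁅f (v γ), f (v δ)⁆ = z * ⁅f (w γ), f (w δ)⁆ * z⁻¹ :=
        eq_mul_inv_of_mul_eq h1.eq.symm
      rw [h6]
      exact (hdz.symm.mul_left h5).mul_left hdz.symm.inv_left
    rw [← map_commutatorElement] at h4
    exact Commute.of_map hf h4
  · intro hj d hd hdy
    -- Reflecting δ to γ in the block makes the image of y γ the required witness.
    obtain ⟨γ, hqγ, hγr, hdγ⟩ := hF₁ _ (hF₁' hr) _ (hL.q_lt_r j) (e d)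
      (hd.trans (hL.q_lt_r j)) δ hqδ (by simpa using hdy)
    rw [e.symm_apply_apply] at hdγ
    refine ⟨f (y γ), hFy _ hr _ hγr, hdγ, ?_⟩
    have h := hP γ δ ⟨hδ, j, hj, hqγ, hγr⟩
    simpa using congrArg f h

theorem mainTheorem3 :
    (∀ μ κ : Cardinal.{u}, μ.IsRegular → κ.IsRegular → Order.succ μ < κ → κ < 2 ^ μ →
      ¬ ∃ (G : Type u) (_ : Group G), IsUniversalForLocallyFinite κ G) ∧
    (∀ κ : Cardinal.{u}, κ.IsRegular → ℵ_ 2 ≤ κ → κ < 2 ^ (ℵ₀ : Cardinal.{u}) →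
      ¬ ∃ (G : Type u) (_ : Group G), IsUniversalForLocallyFinite κ G) := by
  refine ⟨fun μ κ hμ hκ h1 h2 => not_exists_isUniversalForLocallyFinite hμ hκ h1 h2,
    fun κ hκ h1 h2 => not_exists_isUniversalForLocallyFinite isRegular_aleph0 hκ ?_ h2⟩
  refine lt_of_lt_of_le ?_ h1
  rw [succ_aleph0]
  exact aleph_lt_aleph.2 one_lt_two
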